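/- **Setting.** Let $A,B\in\mathbb C^{n\times n}$ form a regular pencil $zB-A$ with Weierstrass canonical form $$TAS=\begin{bmatrix}J&0\\0&I_{n-d}\end{bmatrix},\qquad TBS=\begin{bmatrix}I_d&0\\0&N\end{bmatrix},$$ where $S,T$ are nonsingular, $J$ is block diagonal with upper triangular Jordan blocks of sizes $d_1,\dots,d_m\ge 1$ and eigenvalues $\lambda_1,\dots,\lambda_m$ (not necessarily distinct), $d=d_1+\dots+d_m$, and $N$ is block diagonal with nilpotent Jordan blocks. Let $\Gamma$ be a simple closed curve in $\mathbb C$ such that $\lambda_1,\dots,\lambda_l$ lie inside $\Gamma$ and $\lambda_{l+1},\dots,\lambda_m$ lie outside $\Gamma$ (none on $\Gamma$), and put $s=d_1+\dots+d_l$. Assume that all Jordan blocks belonging to eigenvalues outside $\Gamma$, including the infinite one, have size one, i.e. $d_i=1$ for $i>l$ and $N=0$. Let $z_1,\dots,z_q\in\Gamma$ be quadrature nodes with weights $\omega_1,\dots,\omega_q\in\mathbb C$, put $$\tilde f(\mu)=\frac1{2\pi\sqrt{-1}}\sum_{i=1}^q\frac{\omega_i}{z_i-\mu},\qquad F=\frac1{2\pi\sqrt{-1}}\sum_{i=1}^q\omega_i(z_iB-A)^{-1}B,$$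 and assume $|\tilde f(\lambda_1)|\ge\dots\ge|\tilde f(\lambda_l)|>|\tilde f(\lambda_{l+1})|\ge\dots\ge|\tilde f(\lambda_m)|$. Let $t>s$ and let $l'\in\{1,\dots,m\}$ be such that $\sum_{i<l'}d_i<t\le\sum_{i\le l'}d_i$ (so $l'>l$ and $t\le d$). Let $Y\in\mathbb R^{n\times t}$ be a random matrix whose entries are i.i.d. with a continuous (atomless) distribution, and for each $k\ge 1$ let $R^{(k)}\in\mathbb R^{n\times t}$ be a random matrix whose entries are i.i.d. with a continuous distribution, independent of $Y$. The iterates of RFEAST are $V^{(0)}=Y$ and, for $k\ge1$, $U^{(k)}=FV^{(k-1)}$ with a QR decomposition $U^{(k)}=V^{(k)}C^{(k)}$, where $V^{(k)}\in\mathbb C^{n\times t}$ has orthonormal columns and $C^{(k)}$ is upper triangular. Let $Q_{(k)}$ be the orthogonal projector onto $\operatorname{span}U^{(k)}$, and let $P_{(k)}$ be the oblique projector onto $\operatorname{span}U^{(k)}$ and orthogonal to $\operatorname{span}R^{(k)}$, that is, the idempotent matrix with range $\operatorname{span}U^{(k)}$ and kernel $(\operatorname{span}R^{(k)})^\perp$.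 Put $A_k=P_{(k)}AQ_{(k)}$ and $B_k=P_{(k)}BQ_{(k)}$. For $j=1,\dots,l$ let $p_j=1+d_1+\dots+d_{j-1}$ and let $x_j=S_{(:,p_j)}$, the eigenvector for $\lambda_j$ given by the first column of the $j$th block of $S$. Put $$\sigma_j^{(k)}=\|P_{(k)}(A-\lambda_jB)(I_n-Q_{(k)})\|_2,\qquad \tau_j=\|S_{(:,t+1:n)}\|_2\,\|E_{(:,p_j)}\|_2,$$ where $E=(S^{-1})_{(t+1:n,:)}\,Y\,Z^{-1}$ and $Z=(S^{-1})_{(1:t,:)}\,Y$. In particular, $\tau_j$ depends neither on $k$ nor on the matrices $R^{(k)}$. **Theorem.** With probability $1$ the following holds for all choices of the QR decompositions and all $k\ge1$. If $\tilde f(\lambda_{l'})\neq0$, then the projector $P_{(k)}$ exists and is unique. Whenever $P_{(k)}$ exists, for all $j=1,\dots,l$, $$\|(A_k-\lambda_jB_k)x_j\|_2\le\sigma_j^{(k)}\,\tau_j\left(\frac{|\tilde f(\lambda_{l'})|}{|\tilde f(\lambda_j)|}\right)^k .$$ -/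

import Mathlib

open MeasureTheory ProbabilityTheory
open scoped Matrix Matrix.Norms.L2Operator

namespace RFEAST

/-- The upper triangular `k × k` Jordan block with eigenvalue `a`. -/
def jordanBlock (k : ℕ) (a : ℂ) : Matrix (Fin k) (Fin k) ℂ :=
  Matrix.of fun i j => if i = j then a else if (i : ℕ) + 1 = (j : ℕ) then 1 else 0

/-- The consecutive numbering of rows and columns by blocks: first the blocks of sizes
`d 0, d 1, …`, then the blocks of sizes `d' 0, d' 1, …`. -/
def blockEquiv {n m m' : ℕ} (d : Fin m → ℕ) (d' : Fin m' → ℕ)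
    (hn : ∑ i, d i + ∑ i, d' i = n) :
    ((i : Fin m) × Fin (d i)) ⊕ ((i : Fin m') × Fin (d' i)) ≃ Fin n :=
  ((Equiv.sumCongr finSigmaFinEquiv finSigmaFinEquiv).trans finSumFinEquiv).trans (finCongr hn)

/-- `S` and `T` bring the (necessarily regular) pencil `z B - A` to its Weierstrass canonical form
`T A S = diag(J, I)`, `T B S = diag(I, N)`, where `J` consists of Jordan blocks of sizes `d i` with
eigenvalues `lam i`, and `N` of nilpotent Jordan blocks of sizes `d' i`. -/
structure IsWeierstrassForm {n m m' : ℕ} (A B : Matrix (Fin n) (Fin n) ℂ)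
    (d : Fin m → ℕ) (lam : Fin m → ℂ) (d' : Fin m' → ℕ)
    (hn : ∑ i, d i + ∑ i, d' i = n) (S T : Matrix (Fin n) (Fin n) ℂ) : Prop where
  isUnit_S : IsUnit S
  isUnit_T : IsUnit T
  eq_A : T * A * S = Matrix.reindex (blockEquiv d d' hn) (blockEquiv d d' hn)
    (Matrix.fromBlocks (Matrix.blockDiagonal' fun i => jordanBlock (d i) (lam i)) 0 0 1)
  eq_B : T * B * S = Matrix.reindex (blockEquiv d d' hn) (blockEquiv d d' hn)
    (Matrix.fromBlocks 1 0 0 (Matrix.blockDiagonal' fun i => jordanBlock (d' i) 0))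

/-- The index of the first column of the `j`-th Jordan block,
`d 0 + ⋯ + d (j - 1)` counted from zero. -/
def firstCol {n m m' : ℕ} (d : Fin m → ℕ) (hd : ∀ i, 0 < d i) (d' : Fin m' → ℕ)
    (hn : ∑ i, d i + ∑ i, d' i = n) (j : Fin m) : Fin n :=
  blockEquiv d d' hn (Sum.inl ⟨j, ⟨0, hd j⟩⟩)

/-- `a` lies inside the closed curve `Γ`: in a bounded component of the complement. -/
def Inside (Γ : C(Circle, ℂ)) (a : ℂ) : Prop :=
  a ∉ Set.range Γ ∧ Bornology.IsBounded (connectedComponentIn (Set.range Γ)ᶜ a)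

/-- `a` lies outside the closed curve `Γ`: in an unbounded component of the complement. -/
def Outside (Γ : C(Circle, ℂ)) (a : ℂ) : Prop :=
  a ∉ Set.range Γ ∧ ¬ Bornology.IsBounded (connectedComponentIn (Set.range Γ)ᶜ a)

/-- The quadrature approximation `f̃(a) = (2πi)⁻¹ ∑ⱼ wⱼ / (zⱼ - a)` of
`(2πi)⁻¹ ∮ (z - a)⁻¹ dz`. -/
noncomputable def quadFun {q : ℕ} (z w : Fin q → ℂ) (a : ℂ) : ℂ :=
  (2 * Real.pi * Complex.I)⁻¹ * ∑ j, w j / (z j - a)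

/-- The quadrature approximation `(2πi)⁻¹ ∑ⱼ wⱼ (zⱼ B - A)⁻¹ B` of
`(2πi)⁻¹ ∮ (z B - A)⁻¹ B dz`. -/
noncomputable def quadMat {n q : ℕ} (A B : Matrix (Fin n) (Fin n) ℂ) (z w : Fin q → ℂ) :
    Matrix (Fin n) (Fin n) ℂ :=
  (2 * Real.pi * Complex.I : ℂ)⁻¹ • ∑ j, w j • ((z j • B - A)⁻¹ * B)

/-- The iterates of the algorithm started with `Y`: the `k`-th iteration (`k = 1, 2, …`) computes
`U k` by applying the quadrature rule to `V (k - 1)`, and `V k` is the factor with orthonormal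
columns in a QR decomposition `U k = V k * C` (`C` upper triangular); `V 0 = Y`. -/
structure IsRun {n t q : ℕ} (A B : Matrix (Fin n) (Fin n) ℂ) (z w : Fin q → ℂ)
    (Y : Matrix (Fin n) (Fin t) ℂ) (U V : ℕ → Matrix (Fin n) (Fin t) ℂ) : Prop where
  start : V 0 = Y
  quad : ∀ k, U (k + 1) = quadMat A B z w * V k
  orthonormal : ∀ k, (V (k + 1))ᴴ * V (k + 1) = 1
  qr : ∀ k, ∃ C : Matrix (Fin t) (Fin t) ℂ, C.BlockTriangular id ∧ U (k + 1) = V (k + 1) * C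

/-- The span of the columns of `M`, as a subspace of `ℂⁿ` with the Euclidean inner product. -/
noncomputable def colSpan {n t : ℕ} (M : Matrix (Fin n) (Fin t) ℂ) :
    Submodule ℂ (EuclideanSpace ℂ (Fin n)) :=
  Submodule.span ℂ (Set.range fun j => WithLp.toLp 2 (M.col j))

/-- The matrix of the orthogonal projector onto `K`. -/
noncomputable def orthProjector {n : ℕ} (K : Submodule ℂ (EuclideanSpace ℂ (Fin n))) :
    Matrix (Fin n) (Fin n) ℂ :=
  (Matrix.toEuclideanCLM (n := Fin n) (𝕜 := ℂ)).symm K.starProjection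

/-- `P` is the oblique projector onto `K` and orthogonal to `L`: an idempotent with range `K`
and with kernel the orthogonal complement of `L`. -/
structure IsObliqueProjector {n : ℕ} (P : Matrix (Fin n) (Fin n) ℂ)
    (K L : Submodule ℂ (EuclideanSpace ℂ (Fin n))) : Prop where
  idem : P * P = P
  range_eq : (Matrix.toEuclideanCLM (n := Fin n) (𝕜 := ℂ) P).range = K
  ker_eq : (Matrix.toEuclideanCLM (n := Fin n) (𝕜 := ℂ) P).ker = Lᗮ

/-- The first `t` rows of a matrix with `n ≥ t` rows. -/
def headRows {n t : ℕ} {κ : Type*} (htn : t ≤ n) (M : Matrix (Fin n) κ ℂ) :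
    Matrix (Fin t) κ ℂ :=
  M.submatrix (Fin.castLE htn) id

/-- The rows number `t + 1, …, n` of a matrix with `n` rows. -/
def tailRows {n : ℕ} {κ : Type*} (t : ℕ) (M : Matrix (Fin n) κ ℂ) :
    Matrix {i : Fin n // t ≤ (i : ℕ)} κ ℂ :=
  M.submatrix Subtype.val id

/-- The columns number `t + 1, …, n` of a matrix with `n` columns. -/
def tailCols {n : ℕ} {κ : Type*} (t : ℕ) (M : Matrix κ (Fin n) ℂ) :
    Matrix κ {i : Fin n // t ≤ (i : ℕ)} ℂ :=
  M.submatrix id Subtype.val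

/-- The matrix `E = (S⁻¹)_{(t+1:n,:)} Y Z⁻¹` with `Z = (S⁻¹)_{(1:t,:)} Y`. -/
noncomputable def startError {n t : ℕ} (htn : t ≤ n) (S : Matrix (Fin n) (Fin n) ℂ)
    (Y : Matrix (Fin n) (Fin t) ℂ) : Matrix {i : Fin n // t ≤ (i : ℕ)} (Fin t) ℂ :=
  tailRows t S⁻¹ * Y * (headRows htn S⁻¹ * Y)⁻¹

/-- The constant `τ = ‖S_{(:,t+1:n)}‖₂ ‖E e_p‖₂` belonging to the column number `p < t` of `S`,
where `e_p` is the unit vector of `ℂᵗ` with index `p`. -/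
noncomputable def tau {n t : ℕ} (htn : t ≤ n) (S : Matrix (Fin n) (Fin n) ℂ)
    (Y : Matrix (Fin n) (Fin t) ℂ) (p : Fin n) : ℝ :=
  ‖tailCols t S‖ * ‖WithLp.toLp 2
    (startError htn S Y *ᵥ ((Pi.single p 1 : Fin n → ℂ) ∘ Fin.castLE htn))‖

end RFEAST

/-! In the basis given by the columns of S, the quadrature matrix F becomes M = S⁻¹FS, which is
upper triangular. Its diagonal is f̃(λ_i) on the finite blocks and 0 on the infinite ones. The first
column of every finite block, and every column beyond the blocks inside Γ, is an eigenvector of M.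

Residual bound: the vector v = Z⁻¹e_p is chosen so that S⁻¹Yv = e_p + u, with u supported on the
indices beyond t and equal to E e_p there. Applying M^k and dividing by f̃(λ_j)^k fixes e_p and
multiplies each coordinate of u by a factor of modulus at most the k-th power of the asserted ratio
(`exists_norm_col_sub_le`). Since span U^(k) contains the range of F^k Y
(`IsRun.exists_pow_mul_eq`), this bounds the distance from x_j to span U^(k). As (A - λ_j B)x_j = 0,
the projected residual is at most σ_j times that distance (`norm_residual_le`).

Probability one: only the invertibility of Z and of R^T F^k Y is needed. Both determinants are
polynomials in independent atomless variables, so one nonvanishing value, found from S, suffices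
(`ae_eval_ofReal_ne_zero`). -/

namespace RFEAST

/-! ### Zero sets of polynomials in independent atomless variables -/

section Generic

theorem measurable_eval_ofReal {σ : Type*} [Finite σ] (p : MvPolynomial σ ℂ) :
    Measurable fun x : σ → ℝ => MvPolynomial.eval (fun i => (x i : ℂ)) p :=
  ((MvPolynomial.continuous_eval p).comp
    (continuous_pi fun i => Complex.continuous_ofReal.comp (continuous_apply i))).measurable

theorem measurableSet_eval_ofReal_ne_zero {σ : Type*} [Finite σ] (p : MvPolynomial σ ℂ) :
    MeasurableSet {x : σ → ℝ | MvPolynomial.eval (fun i => (x i : ℂ)) p ≠ 0} :=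
  measurable_eval_ofReal p (measurableSet_singleton (0 : ℂ)).compl

/-- A nonzero polynomial does not vanish almost everywhere with respect to a product of atomless
measures on the line. -/
theorem ae_pi_eval_ofReal_ne_zero : ∀ {N : ℕ} (p : MvPolynomial (Fin N) ℂ), p ≠ 0 →
    ∀ (μ : Fin N → Measure ℝ) [∀ i, SigmaFinite (μ i)] [∀ i, NullSingletonClass (μ i)],
      ∀ᵐ x ∂Measure.pi μ, MvPolynomial.eval (fun i => (x i : ℂ)) p ≠ 0 := by
  intro N
  induction N with
  | zero =>
    intro p hp μ _ _
    refine Filter.Eventually.of_forall fun x hx => hp ?_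
    rw [MvPolynomial.eq_C_of_isEmpty p] at hx ⊢
    rw [MvPolynomial.eval_C] at hx
    rw [hx, map_zero]
  | succ N ih =>
    intro p hp μ _ _
    have hmp := measurePreserving_piFinSuccAbove μ 0
    have hset : MeasurableSet {y : ℝ × (Fin N → ℝ) |
        MvPolynomial.eval (fun i => ((Fin.cons y.1 y.2 : Fin (N + 1) → ℝ) i : ℂ)) p ≠ 0} := by
      have hm : Measurable fun y : ℝ × (Fin N → ℝ) => (Fin.cons y.1 y.2 : Fin (N + 1) → ℝ) := by
        refine measurable_pi_iff.2 fun i => ?_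
        refine Fin.cases ?_ (fun i => ?_) i
        · simpa using measurable_fst
        · simpa [Function.comp_def] using (measurable_pi_apply i).comp measurable_snd
      exact hm (measurableSet_eval_ofReal_ne_zero p)
    have key : ∀ᵐ y ∂(μ 0).prod (Measure.pi fun j => μ ((0 : Fin (N + 1)).succAbove j)),
        MvPolynomial.eval (fun i => ((Fin.cons y.1 y.2 : Fin (N + 1) → ℝ) i : ℂ)) p ≠ 0 := by
      -- Fubini with the remaining variables outermost: outside a null set of these the leading
      -- coefficient in the first variable survives, and then only finitely many values of that
      -- variable are roots.
      rw [Measure.ae_prod_iff_ae_ae hset, Measure.ae_ae_comm hset]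
      set P := MvPolynomial.finSuccEquiv ℂ N p with hP
      have hP0 : P ≠ 0 := by simpa [hP] using hp
      filter_upwards [ih P.leadingCoeff (Polynomial.leadingCoeff_ne_zero.2 hP0)
        fun j => μ ((0 : Fin (N + 1)).succAbove j)] with x hx
      have hQ : P.map (MvPolynomial.eval fun i => (x i : ℂ)) ≠ 0 := by
        intro h
        apply hx
        have := congrArg (fun Q => Polynomial.coeff Q P.natDegree) h
        simpa [Polynomial.coeff_map] using this
      have hfin : {a : ℝ | (P.map (MvPolynomial.eval fun i => (x i : ℂ))).IsRoot (a : ℂ)}.Finite :=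
        (Polynomial.finite_setOfPred_isRoot hQ).preimage Complex.ofReal_injective.injOn
      refine (measure_eq_zero_iff_ae_notMem.1 (hfin.measure_zero (μ 0))).mono fun a ha h => ha ?_
      have hc : (fun i => ((Fin.cons a x : Fin (N + 1) → ℝ) i : ℂ)) =
          Fin.cons (a : ℂ) fun i => (x i : ℂ) := by
        funext i
        refine Fin.cases ?_ (fun i => ?_) i <;> simp
      simp only [hc, MvPolynomial.eval_eq_eval_mv_eval'] at h
      exact h
    have := hmp.quasiMeasurePreserving.ae key
    refine this.mono fun x hx => ?_
    have hc : (Fin.cons (MeasurableEquiv.piFinSuccAbove (fun _ => ℝ) 0 x).1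
        (MeasurableEquiv.piFinSuccAbove (fun _ => ℝ) 0 x).2 : Fin (N + 1) → ℝ) = x :=
      Fin.cons_self_tail x
    rwa [hc] at hx

/-- A nonzero polynomial in independent atomless real random variables is almost surely nonzero. -/
theorem ae_eval_ofReal_ne_zero {σ Ω : Type*} [Fintype σ] [MeasurableSpace Ω] {ρ : Measure Ω}
    [IsProbabilityMeasure ρ] {X : σ → Ω → ℝ} (hX : ∀ i, AEMeasurable (X i) ρ)
    (hat : ∀ i, NullSingletonClass (ρ.map (X i))) (hind : iIndepFun X ρ)
    (p : MvPolynomial σ ℂ) (hp : p ≠ 0) :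
    ∀ᵐ ω ∂ρ, MvPolynomial.eval (fun i => (X i ω : ℂ)) p ≠ 0 := by
  let e := Fintype.equivFin σ
  have hind' : iIndepFun (fun i => X (e.symm i)) ρ := hind.precomp e.symm.injective
  have hX' : ∀ i, AEMeasurable (X (e.symm i)) ρ := fun i => hX _
  have : ∀ i, IsProbabilityMeasure (ρ.map (X (e.symm i))) := fun i =>
    Measure.isProbabilityMeasure_map (hX' i)
  have : ∀ i, NullSingletonClass (ρ.map (X (e.symm i))) := fun i => hat _
  have hp' : MvPolynomial.rename e p ≠ 0 := fun h =>
    hp (MvPolynomial.rename_injective e e.injective (by rw [h, map_zero]))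
  have h := ae_pi_eval_ofReal_ne_zero _ hp' fun i => ρ.map (X (e.symm i))
  rw [← (iIndepFun_iff_map_fun_eq_pi_map hX').1 hind'] at h
  refine (ae_of_ae_map (aemeasurable_pi_lambda _ hX') h).mono fun ω hω => ?_
  rw [MvPolynomial.eval_rename] at hω
  simpa [Function.comp_def] using hω

end Generic


/-! ### Diagonals of upper triangular matrices -/

section Triangular

variable {ι : Type*} [Fintype ι] [LinearOrder ι]

theorem blockTriangular_mul_apply_self {X Y : Matrix ι ι ℂ} (hX : X.BlockTriangular id)
    (hY : Y.BlockTriangular id) (i : ι) : (X * Y) i i = X i i * Y i i := by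
  rw [Matrix.mul_apply, Finset.sum_eq_single i]
  · intro j _ hj
    rcases lt_or_gt_of_ne hj with h | h
    · rw [hX h, zero_mul]
    · rw [hY h, mul_zero]
  · simp

theorem blockTriangular_inv {X : Matrix ι ι ℂ} (hX : X.BlockTriangular id) (hu : IsUnit X) :
    X⁻¹.BlockTriangular id := by
  have := hu.invertible
  exact Matrix.blockTriangular_inv_of_blockTriangular hX

theorem blockTriangular_inv_apply_self {X : Matrix ι ι ℂ} (hX : X.BlockTriangular id)
    (hu : IsUnit X) (i : ι) : X⁻¹ i i = (X i i)⁻¹ := by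
  have h := blockTriangular_mul_apply_self (blockTriangular_inv hX hu) hX i
  rw [Matrix.nonsing_inv_mul _ ((Matrix.isUnit_iff_isUnit_det _).1 hu), Matrix.one_apply_eq] at h
  exact eq_inv_of_mul_eq_one_left h.symm

theorem isUnit_of_blockTriangular {X : Matrix ι ι ℂ} (hX : X.BlockTriangular id)
    (h : ∀ i, X i i ≠ 0) : IsUnit X := by
  rw [Matrix.isUnit_iff_isUnit_det, Matrix.det_of_isUpperTriangular hX, isUnit_iff_ne_zero]
  exact Finset.prod_ne_zero_iff.2 fun i _ => h i

end Triangular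

/-! ### Positions of the Jordan blocks in the consecutive numbering -/

section BlockOrder

variable {n m m' : ℕ} (d : Fin m → ℕ) (d' : Fin m' → ℕ) (hn : ∑ i, d i + ∑ i, d' i = n)

theorem blockEquiv_inl_val (i : Fin m) (a : Fin (d i)) :
    (blockEquiv d d' hn (Sum.inl ⟨i, a⟩) : ℕ) = ∑ i' with i' < i, d i' + a := by
  have h : (blockEquiv d d' hn (Sum.inl ⟨i, a⟩) : ℕ) = finSigmaFinEquiv ⟨i, a⟩ := by
    simp [blockEquiv]
  rw [h, finSigmaFinEquiv_apply]
  congr 1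
  refine Finset.sum_bij (fun x _ => Fin.castLE i.2.le x) ?_ ?_ ?_ ?_
  · intro x _
    exact Finset.mem_filter.2 ⟨Finset.mem_univ _, Fin.lt_def.2 x.2⟩
  · intro x _ y _ hxy
    simpa using hxy
  · intro b hb
    exact ⟨⟨b, Fin.lt_def.1 (Finset.mem_filter.1 hb).2⟩, Finset.mem_univ _, rfl⟩
  · simp

theorem blockEquiv_inr_val_ge (x : (i : Fin m') × Fin (d' i)) :
    ∑ i, d i ≤ (blockEquiv d d' hn (Sum.inr x) : ℕ) := by
  simp [blockEquiv]

theorem sum_lt_add (i : Fin m) : ∑ i' with i' < i, d i' + d i = ∑ i' with i' ≤ i, d i' := by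
  have : (Finset.univ.filter fun i' : Fin m => i' ≤ i) =
      insert i (Finset.univ.filter fun i' : Fin m => i' < i) := by
    ext x
    simp [le_iff_eq_or_lt]
  rw [this, Finset.sum_insert (by simp), add_comm]

theorem sum_le_le_sum_lt {i j : Fin m} (h : i < j) :
    ∑ i' with i' ≤ i, d i' ≤ ∑ i' with i' < j, d i' :=
  Finset.sum_le_sum_of_subset fun x hx => by
    simp only [Finset.mem_filter, Finset.mem_univ, true_and] at hx ⊢
    exact hx.trans_lt h

theorem sum_le_le_sum_val_lt {l : ℕ} {j : Fin m} (h : (j : ℕ) < l) :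
    ∑ i' with i' ≤ j, d i' ≤ ∑ i ∈ Finset.univ.filter (fun i : Fin m => (i : ℕ) < l), d i :=
  Finset.sum_le_sum_of_subset fun x hx => by
    simp only [Finset.mem_filter, Finset.mem_univ, true_and, Fin.le_def] at hx ⊢
    omega

/-- The cut at t falls in block l'. This lemma and the next turn the ordering of the values
|f̃(λ_i)| by blocks into bounds on the diagonal of M before and after t. -/
theorem le_of_blockEquiv_lt {t : ℕ} {l' : Fin m} (hl' : t ≤ ∑ i with i ≤ l', d i) {i : Fin m}
    {a : Fin (d i)} (h : (blockEquiv d d' hn (Sum.inl ⟨i, a⟩) : ℕ) < t) : i ≤ l' := by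
  by_contra! hlt
  have := sum_le_le_sum_lt d hlt
  rw [blockEquiv_inl_val] at h
  omega

theorem le_of_le_blockEquiv {t : ℕ} {l' : Fin m} (hl' : ∑ i with i < l', d i < t) {i : Fin m}
    {a : Fin (d i)} (h : t ≤ (blockEquiv d d' hn (Sum.inl ⟨i, a⟩) : ℕ)) : l' ≤ i := by
  by_contra! hlt
  have := sum_le_le_sum_lt d hlt
  have := sum_lt_add d i
  have := a.2
  rw [blockEquiv_inl_val] at h
  omega

theorem blockEquiv_lt_of_val_lt {l : ℕ} {i : Fin m} (a : Fin (d i)) (h : (i : ℕ) < l) :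
    (blockEquiv d d' hn (Sum.inl ⟨i, a⟩) : ℕ) <
      ∑ i ∈ Finset.univ.filter (fun i : Fin m => (i : ℕ) < l), d i := by
  have := sum_le_le_sum_val_lt d h
  have := sum_lt_add d i
  have := a.2
  rw [blockEquiv_inl_val]
  omega

end BlockOrder

/-! ### The canonical forms of A and B -/

section Weierstrass

variable {n m m' : ℕ} (d : Fin m → ℕ) (lam : Fin m → ℂ) (d' : Fin m' → ℕ)
  (hn : ∑ i, d i + ∑ i, d' i = n)

/-- The canonical form `diag(J, I)` of `A`. -/
def weierstrassA : Matrix (Fin n) (Fin n) ℂ :=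
  Matrix.reindex (blockEquiv d d' hn) (blockEquiv d d' hn)
    (Matrix.fromBlocks (Matrix.blockDiagonal' fun i => jordanBlock (d i) (lam i)) 0 0 1)

/-- The canonical form `diag(I, N)` of `B`. -/
def weierstrassB : Matrix (Fin n) (Fin n) ℂ :=
  Matrix.reindex (blockEquiv d d' hn) (blockEquiv d d' hn)
    (Matrix.fromBlocks 1 0 0 (Matrix.blockDiagonal' fun i => jordanBlock (d' i) 0))

/-- The diagonal with the value `g i` on the `i`-th finite block and `0` on the infinite ones. -/
def blockFun (g : Fin m → ℂ) (i : Fin n) : ℂ :=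
  Sum.elim (fun x => g x.1) (fun _ => 0) ((blockEquiv d d' hn).symm i)

theorem blockFun_inl (g : Fin m → ℂ) (x : (i : Fin m) × Fin (d i)) :
    blockFun d d' hn g (blockEquiv d d' hn (Sum.inl x)) = g x.1 := by
  simp [blockFun]

theorem blockFun_inr (g : Fin m → ℂ) (x : (i : Fin m') × Fin (d' i)) :
    blockFun d d' hn g (blockEquiv d d' hn (Sum.inr x)) = 0 := by
  simp [blockFun]

theorem jordanBlock_infinite_eq_zero (h : ∀ i, d' i = 1) :
    (Matrix.blockDiagonal' fun i => jordanBlock (d' i) 0) = 0 := by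
  have hJ : (fun i => jordanBlock (d' i) 0) = 0 := by
    funext i
    ext a b
    have := a.2
    have := b.2
    have := h i
    simp only [jordanBlock, Matrix.of_apply, Pi.zero_apply, Matrix.zero_apply]
    rw [if_neg (show ¬ ((a : ℕ) + 1 = b) by omega)]
    simp
  rw [hJ, Matrix.blockDiagonal'_zero]

theorem weierstrassA_blockTriangular : (weierstrassA d lam d' hn).BlockTriangular id := by
  intro p q hpq
  obtain ⟨x, rfl⟩ := (blockEquiv d d' hn).surjective p
  obtain ⟨y, rfl⟩ := (blockEquiv d d' hn).surjective q
  simp only [weierstrassA, Matrix.reindex_apply, Matrix.submatrix_apply, Equiv.symm_apply_apply]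
  rcases x with ⟨i, a⟩ | x <;> rcases y with ⟨j, b⟩ | y
  · rw [Matrix.fromBlocks_apply₁₁]
    by_cases hij : i = j
    · subst hij
      rw [Matrix.blockDiagonal'_apply_eq]
      simp only [id, Fin.lt_def, blockEquiv_inl_val] at hpq
      rw [jordanBlock, Matrix.of_apply, if_neg (fun h => by subst h; omega),
        if_neg (by omega)]
    · rw [Matrix.blockDiagonal'_apply_ne _ _ _ hij]
  · rfl
  · rfl
  · rw [Matrix.fromBlocks_apply₂₂, Matrix.one_apply_ne]
    rintro rfl
    exact lt_irrefl _ hpq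

theorem weierstrassB_eq (h : ∀ i, d' i = 1) :
    weierstrassB d d' hn = Matrix.diagonal (blockFun d d' hn fun _ => 1) := by
  rw [weierstrassB, jordanBlock_infinite_eq_zero d' h, ← Matrix.diagonal_one,
    ← Matrix.diagonal_zero, Matrix.fromBlocks_diagonal, Matrix.reindex_apply,
    Matrix.submatrix_diagonal_equiv]
  congr 1

theorem weierstrassA_apply_inl_self (x : (i : Fin m) × Fin (d i)) :
    weierstrassA d lam d' hn (blockEquiv d d' hn (Sum.inl x)) (blockEquiv d d' hn (Sum.inl x)) =
      lam x.1 := by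
  obtain ⟨i, a⟩ := x
  simp [weierstrassA, Matrix.blockDiagonal'_apply_eq, jordanBlock]

theorem weierstrassA_apply_inr_self (x : (i : Fin m') × Fin (d' i)) :
    weierstrassA d lam d' hn (blockEquiv d d' hn (Sum.inr x)) (blockEquiv d d' hn (Sum.inr x)) =
      1 := by
  simp [weierstrassA]

theorem weierstrassA_col_inl (j : Fin m) (a : Fin (d j)) (ha : (a : ℕ) = 0) :
    weierstrassA d lam d' hn *ᵥ Pi.single (blockEquiv d d' hn (Sum.inl ⟨j, a⟩)) 1 =
      lam j • Pi.single (blockEquiv d d' hn (Sum.inl ⟨j, a⟩)) 1 := by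
  rw [Matrix.mulVec_single_one]
  funext p
  obtain ⟨x, rfl⟩ := (blockEquiv d d' hn).surjective p
  simp only [weierstrassA, Matrix.reindex_apply, Matrix.submatrix_apply, Equiv.symm_apply_apply,
    Matrix.col_apply, Pi.smul_apply, Pi.single_apply, EmbeddingLike.apply_eq_iff_eq]
  rcases x with ⟨i, b⟩ | x
  · rw [Matrix.fromBlocks_apply₁₁]
    by_cases hij : i = j
    · subst hij
      rw [Matrix.blockDiagonal'_apply_eq, jordanBlock, Matrix.of_apply,
        if_neg (show ¬ ((b : ℕ) + 1 = a) by omega)]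
      simp
    · rw [Matrix.blockDiagonal'_apply_ne _ _ _ hij]
      simp [hij]
  · simp

end Weierstrass

/-! ### The quadrature matrix in the canonical basis -/

section Filter

variable {n m m' q : ℕ} {A B S T : Matrix (Fin n) (Fin n) ℂ} {d : Fin m → ℕ} {lam : Fin m → ℂ}
  {d' : Fin m' → ℕ} {hn : ∑ i, d i + ∑ i, d' i = n} {z w : Fin q → ℂ}

/-- The quadrature matrix in the basis of the canonical form. -/
noncomputable def quadForm (A B S : Matrix (Fin n) (Fin n) ℂ) (z w : Fin q → ℂ) :
    Matrix (Fin n) (Fin n) ℂ :=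
  S⁻¹ * quadMat A B z w * S

/-- S⁻¹(zB - A)⁻¹BS = (T(zB - A)S)⁻¹(TBS), as T cancels. Invertibility of zB - A plays no role,
because `Matrix.mul_inv_rev` holds unconditionally. -/
theorem quadForm_eq (hW : IsWeierstrassForm A B d lam d' hn S T) :
    quadForm A B S z w = (2 * Real.pi * Complex.I : ℂ)⁻¹ • ∑ j, w j •
      ((z j • weierstrassB d d' hn - weierstrassA d lam d' hn)⁻¹ * weierstrassB d d' hn) := by
  rw [quadForm, quadMat, Matrix.mul_smul, Matrix.smul_mul, Matrix.mul_sum, Matrix.sum_mul]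
  congr 1
  refine Finset.sum_congr rfl fun j _ => ?_
  rw [Matrix.mul_smul, Matrix.smul_mul]
  congr 1
  have hT := (Matrix.isUnit_iff_isUnit_det _).1 hW.isUnit_T
  have hB : weierstrassB d d' hn = T * B * S := hW.eq_B.symm
  have hA : weierstrassA d lam d' hn = T * A * S := hW.eq_A.symm
  have hK : z j • (T * B * S) - T * A * S = T * (z j • B - A) * S := by
    simp [Matrix.mul_sub, Matrix.sub_mul]
  rw [hA, hB, hK, Matrix.mul_inv_rev, Matrix.mul_inv_rev]
  simp only [Matrix.mul_assoc]
  rw [Matrix.nonsing_inv_mul_cancel_left _ _ hT]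

theorem resolvent_blockTriangular (hd' : ∀ i, d' i = 1) (a : ℂ) :
    (a • weierstrassB d d' hn - weierstrassA d lam d' hn).BlockTriangular id := by
  rw [weierstrassB_eq d d' hn hd', ← Matrix.diagonal_smul]
  exact (Matrix.blockTriangular_diagonal _).sub (weierstrassA_blockTriangular ..)

theorem resolvent_apply_inl_self (hd' : ∀ i, d' i = 1) (a : ℂ) (x : (i : Fin m) × Fin (d i)) :
    (a • weierstrassB d d' hn - weierstrassA d lam d' hn)
      (blockEquiv d d' hn (Sum.inl x)) (blockEquiv d d' hn (Sum.inl x)) = a - lam x.1 := by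
  simp [weierstrassB_eq d d' hn hd', weierstrassA_apply_inl_self, blockFun_inl]

theorem resolvent_apply_inr_self (hd' : ∀ i, d' i = 1) (a : ℂ) (x : (i : Fin m') × Fin (d' i)) :
    (a • weierstrassB d d' hn - weierstrassA d lam d' hn)
      (blockEquiv d d' hn (Sum.inr x)) (blockEquiv d d' hn (Sum.inr x)) = -1 := by
  simp [weierstrassB_eq d d' hn hd', weierstrassA_apply_inr_self, blockFun_inr]

theorem isUnit_resolvent (hd' : ∀ i, d' i = 1) {a : ℂ} (ha : ∀ j, a ≠ lam j) :
    IsUnit (a • weierstrassB d d' hn - weierstrassA d lam d' hn) := by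
  refine isUnit_of_blockTriangular (resolvent_blockTriangular hd' a) fun p => ?_
  obtain ⟨x | x, rfl⟩ := (blockEquiv d d' hn).surjective p
  · rw [resolvent_apply_inl_self hd']
    exact sub_ne_zero.2 (ha _)
  · rw [resolvent_apply_inr_self hd']
    simp

theorem quadForm_blockTriangular (hW : IsWeierstrassForm A B d lam d' hn S T)
    (hd' : ∀ i, d' i = 1) (hz : ∀ i j, z i ≠ lam j) :
    (quadForm A B S z w).BlockTriangular id := by
  rw [quadForm_eq hW]
  intro p r hpr
  rw [Matrix.smul_apply, Matrix.sum_apply, Finset.sum_eq_zero, smul_zero]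
  intro j _
  have hB : (weierstrassB d d' hn).BlockTriangular id := by
    rw [weierstrassB_eq d d' hn hd']
    exact Matrix.blockTriangular_diagonal _
  rw [Matrix.smul_apply, ((blockTriangular_inv (resolvent_blockTriangular hd' (z j))
    (isUnit_resolvent hd' (hz j))).mul hB) hpr, smul_zero]

/-- Diagonals of triangular matrices multiply and invert entrywise: a finite index gives (z - λ)⁻¹ ·
1, an infinite one (-1)⁻¹ · 0. -/
theorem quadForm_apply_self (hW : IsWeierstrassForm A B d lam d' hn S T)
    (hd' : ∀ i, d' i = 1) (hz : ∀ i j, z i ≠ lam j) (p : Fin n) :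
    quadForm A B S z w p p = blockFun d d' hn (fun i => quadFun z w (lam i)) p := by
  have hB : (weierstrassB d d' hn).BlockTriangular id := by
    rw [weierstrassB_eq d d' hn hd']
    exact Matrix.blockTriangular_diagonal _
  have key (j : Fin q) : ((z j • weierstrassB d d' hn - weierstrassA d lam d' hn)⁻¹ *
      weierstrassB d d' hn) p p =
      ((z j • weierstrassB d d' hn - weierstrassA d lam d' hn) p p)⁻¹ *
        weierstrassB d d' hn p p := by
    rw [blockTriangular_mul_apply_self (blockTriangular_inv (resolvent_blockTriangular hd' (z j))
      (isUnit_resolvent hd' (hz j))) hB,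
      blockTriangular_inv_apply_self (resolvent_blockTriangular hd' (z j))
      (isUnit_resolvent hd' (hz j))]
  rw [quadForm_eq hW, Matrix.smul_apply, Matrix.sum_apply]
  simp only [Matrix.smul_apply, key]
  obtain ⟨x | x, rfl⟩ := (blockEquiv d d' hn).surjective p
  · simp only [resolvent_apply_inl_self hd']
    simp [weierstrassB_eq d d' hn hd', blockFun_inl, quadFun, div_eq_mul_inv]
  · simp [weierstrassB_eq d d' hn hd', blockFun_inr]

theorem weierstrassB_mulVec_single (hd' : ∀ i, d' i = 1) (p : Fin n) :
    weierstrassB d d' hn *ᵥ Pi.single p 1 =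
      blockFun d d' hn (fun _ => 1) p • (Pi.single p 1 : Fin n → ℂ) := by
  rw [weierstrassB_eq d d' hn hd', Matrix.diagonal_mulVec_single]
  funext i
  simp [Pi.single_apply]

theorem quadForm_mulVec (hW : IsWeierstrassForm A B d lam d' hn S T) (v : Fin n → ℂ) :
    quadForm A B S z w *ᵥ v = (2 * Real.pi * Complex.I : ℂ)⁻¹ • ∑ j, w j •
      ((z j • weierstrassB d d' hn - weierstrassA d lam d' hn)⁻¹ *ᵥ
        (weierstrassB d d' hn *ᵥ v)) := by
  rw [quadForm_eq hW, Matrix.smul_mulVec, Matrix.sum_mulVec]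
  simp [Matrix.smul_mulVec, Matrix.mulVec_mulVec]

/-- The first column of a finite block is an eigenvector of the quadrature matrix. -/
theorem quadForm_mulVec_inl (hW : IsWeierstrassForm A B d lam d' hn S T)
    (hd' : ∀ i, d' i = 1) (hz : ∀ i j, z i ≠ lam j) (j : Fin m) (a : Fin (d j))
    (ha : (a : ℕ) = 0) :
    quadForm A B S z w *ᵥ Pi.single (blockEquiv d d' hn (Sum.inl ⟨j, a⟩)) 1 =
      quadFun z w (lam j) • Pi.single (blockEquiv d d' hn (Sum.inl ⟨j, a⟩)) 1 := by
  rw [quadForm_mulVec hW, weierstrassB_mulVec_single hd', blockFun_inl, one_smul, quadFun,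
    mul_smul, Finset.sum_smul]
  congr 1
  refine Finset.sum_congr rfl fun i _ => ?_
  set e : Fin n → ℂ := Pi.single (blockEquiv d d' hn (Sum.inl ⟨j, a⟩)) 1 with he
  have hdet := (Matrix.isUnit_iff_isUnit_det _).1
    (isUnit_resolvent (hn := hn) hd' (lam := lam) (hz i))
  -- The pencil acts on `e` as the scalar z_i - λ_j, hence its inverse as the reciprocal.
  have hK : (z i • weierstrassB d d' hn - weierstrassA d lam d' hn) *ᵥ e =
      (z i - lam j) • e := by
    rw [Matrix.sub_mulVec, Matrix.smul_mulVec, he, weierstrassB_mulVec_single hd', blockFun_inl,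
      weierstrassA_col_inl d lam d' hn j a ha, one_smul, sub_smul]
  have hinv : e = (z i - lam j) •
      ((z i • weierstrassB d d' hn - weierstrassA d lam d' hn)⁻¹ *ᵥ e) := by
    rw [← Matrix.mulVec_smul, ← hK, Matrix.mulVec_mulVec, Matrix.nonsing_inv_mul _ hdet,
      Matrix.one_mulVec]
  have h0 : z i - lam j ≠ 0 := sub_ne_zero.2 (hz i j)
  conv_rhs => rw [hinv, smul_smul, div_mul_cancel₀ _ h0]

theorem quadForm_mulVec_inr (hW : IsWeierstrassForm A B d lam d' hn S T)
    (hd' : ∀ i, d' i = 1) (x : (i : Fin m') × Fin (d' i)) :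
    quadForm A B S z w *ᵥ Pi.single (blockEquiv d d' hn (Sum.inr x)) 1 = 0 := by
  rw [quadForm_mulVec hW, weierstrassB_mulVec_single hd', blockFun_inr]
  simp

/-- Beyond the blocks inside the curve, the unit vectors are eigenvectors. -/
theorem quadForm_mulVec_tail (hW : IsWeierstrassForm A B d lam d' hn S T)
    (hd' : ∀ i, d' i = 1) (hz : ∀ i j, z i ≠ lam j) {l : ℕ}
    (hsimple : ∀ i : Fin m, l ≤ (i : ℕ) → d i = 1) {p : Fin n}
    (hp : ∑ i ∈ Finset.univ.filter (fun i : Fin m => (i : ℕ) < l), d i ≤ p) :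
    quadForm A B S z w *ᵥ Pi.single p 1 =
      blockFun d d' hn (fun i => quadFun z w (lam i)) p • (Pi.single p 1 : Fin n → ℂ) := by
  obtain ⟨⟨j, a⟩ | x, rfl⟩ := (blockEquiv d d' hn).surjective p
  -- A finite index past the inner blocks lies in a block of size one, so it is the first column of
  -- its block.
  · have hl : l ≤ (j : ℕ) := by
      by_contra! h
      exact absurd (blockEquiv_lt_of_val_lt d d' hn a h) hp.not_gt
    rw [quadForm_mulVec_inl hW hd' hz, blockFun_inl]
    have := a.2
    have := hsimple j hl
    omega
  · rw [quadForm_mulVec_inr hW hd', blockFun_inr, zero_smul]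

theorem norm_blockFun_le {g : Fin m → ℂ} (hg : Antitone fun i => ‖g i‖) {t : ℕ} {l' : Fin m}
    (hl' : ∑ i with i < l', d i < t) {p : Fin n} (hp : t ≤ p) :
    ‖blockFun d d' hn g p‖ ≤ ‖g l'‖ := by
  obtain ⟨⟨j, a⟩ | x, rfl⟩ := (blockEquiv d d' hn).surjective p
  · rw [blockFun_inl]
    exact hg (le_of_le_blockEquiv d d' hn hl' hp)
  · rw [blockFun_inr]
    simp

theorem norm_le_norm_blockFun {g : Fin m → ℂ} (hg : Antitone fun i => ‖g i‖) {t : ℕ}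
    {l' : Fin m} (hl' : t ≤ ∑ i with i ≤ l', d i) {p : Fin n} (hp : (p : ℕ) < t) :
    ‖g l'‖ ≤ ‖blockFun d d' hn g p‖ := by
  obtain ⟨⟨j, a⟩ | x, rfl⟩ := (blockEquiv d d' hn).surjective p
  · rw [blockFun_inl]
    exact hg (le_of_blockEquiv_lt d d' hn hl' hp)
  -- Infinite indices come after all finite blocks, hence not before t.
  · have h1 := blockEquiv_inr_val_ge d d' hn x
    have h2 : ∑ i with i ≤ l', d i ≤ ∑ i, d i := Finset.sum_le_univ_sum_of_nonneg (by simp)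
    omega

/-- The first column of the `j`-th block of `S` is an eigenvector of the pencil. -/
theorem mulVec_col_firstCol (hW : IsWeierstrassForm A B d lam d' hn S T)
    (hd : ∀ i, 0 < d i) (hd' : ∀ i, d' i = 1) (j : Fin m) :
    (A - lam j • B) *ᵥ S.col (firstCol d hd d' hn j) = 0 := by
  have hT := (Matrix.isUnit_iff_isUnit_det _).1 hW.isUnit_T
  have hB : T * B * S = weierstrassB d d' hn := hW.eq_B
  have hA : T * A * S = weierstrassA d lam d' hn := hW.eq_A
  have h : T *ᵥ ((A - lam j • B) *ᵥ S.col (firstCol d hd d' hn j)) = 0 := by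
    rw [← Matrix.mulVec_single_one, Matrix.mulVec_mulVec, Matrix.mulVec_mulVec,
      Matrix.mul_sub, Matrix.sub_mul, Matrix.mul_smul, Matrix.smul_mul, hA, hB,
      Matrix.sub_mulVec, Matrix.smul_mulVec, weierstrassB_mulVec_single hd', firstCol,
      weierstrassA_col_inl d lam d' hn j _ rfl, blockFun_inl, one_smul, sub_self]
  have := congrArg (fun v => T⁻¹ *ᵥ v) h
  simpa [Matrix.mulVec_mulVec, Matrix.nonsing_inv_mul_cancel_left _ _ hT] using this

end Filter


/-! ### Orthogonal and oblique projectors -/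

section Projector

variable {n t : ℕ}

theorem mem_colSpan {M : Matrix (Fin n) (Fin t) ℂ} {x : EuclideanSpace ℂ (Fin n)} :
    x ∈ colSpan M ↔ ∃ v : Fin t → ℂ, WithLp.toLp 2 (M *ᵥ v) = x := by
  rw [colSpan, Submodule.mem_span_range_iff_exists_fun]
  refine exists_congr fun v => ?_
  rw [Matrix.mulVec_eq_sum, WithLp.toLp_sum]
  simp [Matrix.col]

theorem mem_orthogonal_colSpan {M : Matrix (Fin n) (Fin t) ℂ} {x : EuclideanSpace ℂ (Fin n)} :
    x ∈ (colSpan M)ᗮ ↔ Mᴴ *ᵥ x.ofLp = 0 := by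
  rw [Submodule.mem_orthogonal]
  constructor
  · intro h
    funext j
    have := h (WithLp.toLp 2 (M.col j)) (Submodule.subset_span ⟨j, rfl⟩)
    rw [EuclideanSpace.inner_eq_star_dotProduct, dotProduct_comm] at this
    exact this
  · intro h y hy
    obtain ⟨v, rfl⟩ := mem_colSpan.1 hy
    rw [EuclideanSpace.inner_eq_star_dotProduct, dotProduct_comm, Matrix.star_mulVec,
      ← Matrix.dotProduct_mulVec, h, dotProduct_zero]

theorem mem_range_toEuclideanCLM {P : Matrix (Fin n) (Fin n) ℂ} {x : EuclideanSpace ℂ (Fin n)} :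
    x ∈ (Matrix.toEuclideanCLM (n := Fin n) (𝕜 := ℂ) P).range ↔
      ∃ v : Fin n → ℂ, WithLp.toLp 2 (P *ᵥ v) = x :=
  ⟨fun ⟨y, hy⟩ => ⟨y.ofLp, hy⟩, fun ⟨v, hv⟩ => ⟨WithLp.toLp 2 v, hv⟩⟩

theorem mem_ker_toEuclideanCLM {P : Matrix (Fin n) (Fin n) ℂ} {x : EuclideanSpace ℂ (Fin n)} :
    x ∈ (Matrix.toEuclideanCLM (n := Fin n) (𝕜 := ℂ) P).ker ↔ P *ᵥ x.ofLp = 0 :=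
  ⟨fun h => congrArg WithLp.ofLp (show WithLp.toLp 2 (P *ᵥ x.ofLp) = 0 from h),
    fun h => show WithLp.toLp 2 (P *ᵥ x.ofLp) = 0 by rw [h, WithLp.toLp_zero]⟩

/-- Equal ranges give PP' = P', since P fixes its range; equal kernels give PP' = P, since P kills
P'x - x. -/
theorem IsObliqueProjector.eq {P P' : Matrix (Fin n) (Fin n) ℂ}
    {K L : Submodule ℂ (EuclideanSpace ℂ (Fin n))} (hP : IsObliqueProjector P K L)
    (hP' : IsObliqueProjector P' K L) : P = P' := by
  have h1 : P * P' = P' := by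
    refine Matrix.ext_of_mulVec_single fun i => ?_
    have : WithLp.toLp 2 (P' *ᵥ Pi.single i 1) ∈
        (Matrix.toEuclideanCLM (n := Fin n) (𝕜 := ℂ) P).range := by
      rw [hP.range_eq, ← hP'.range_eq]
      exact mem_range_toEuclideanCLM.2 ⟨_, rfl⟩
    obtain ⟨v, hv⟩ := mem_range_toEuclideanCLM.1 this
    rw [← Matrix.mulVec_mulVec, ← WithLp.toLp_injective 2 hv, Matrix.mulVec_mulVec, hP.idem]
  have h2 : P * P' = P := by
    refine Matrix.ext_of_mulVec_single fun i => ?_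
    have : WithLp.toLp 2 (P' *ᵥ Pi.single i 1 - Pi.single i 1) ∈
        (Matrix.toEuclideanCLM (n := Fin n) (𝕜 := ℂ) P).ker := by
      rw [hP.ker_eq, ← hP'.ker_eq, mem_ker_toEuclideanCLM]
      rw [Matrix.mulVec_sub, Matrix.mulVec_mulVec, hP'.idem, sub_self]
    have := mem_ker_toEuclideanCLM.1 this
    rw [Matrix.mulVec_sub, sub_eq_zero] at this
    rw [← Matrix.mulVec_mulVec, this]
  rw [← h2, h1]

/-- The oblique projector `U (Rᴴ U)⁻¹ Rᴴ`. -/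
theorem isObliqueProjector_of_isUnit {U R : Matrix (Fin n) (Fin t) ℂ} (h : IsUnit (Rᴴ * U).det) :
    IsObliqueProjector (U * (Rᴴ * U)⁻¹ * Rᴴ) (colSpan U) (colSpan R) where
  idem := by
    have : U * (Rᴴ * U)⁻¹ * Rᴴ * (U * (Rᴴ * U)⁻¹ * Rᴴ) =
        U * ((Rᴴ * U)⁻¹ * (Rᴴ * U) * (Rᴴ * U)⁻¹) * Rᴴ := by
      simp only [Matrix.mul_assoc]
    rw [this, Matrix.nonsing_inv_mul _ h, Matrix.one_mul]
  range_eq := by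
    ext x
    rw [mem_range_toEuclideanCLM, mem_colSpan]
    constructor
    · rintro ⟨v, rfl⟩
      exact ⟨(Rᴴ * U)⁻¹ *ᵥ (Rᴴ *ᵥ v), by simp only [Matrix.mulVec_mulVec, Matrix.mul_assoc]⟩
    · rintro ⟨v, rfl⟩
      refine ⟨U *ᵥ v, ?_⟩
      rw [Matrix.mulVec_mulVec, Matrix.mul_assoc, Matrix.mul_assoc, Matrix.nonsing_inv_mul _ h,
        Matrix.mul_one]
  ker_eq := by
    ext x
    rw [mem_ker_toEuclideanCLM, mem_orthogonal_colSpan]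
    constructor
    · intro hx
      have := congrArg (fun v => Rᴴ *ᵥ v) hx
      simp only [Matrix.mulVec_mulVec, Matrix.mulVec_zero] at this
      rwa [← Matrix.mul_assoc, ← Matrix.mul_assoc, Matrix.mul_nonsing_inv _ h,
        Matrix.one_mul] at this
    · intro hx
      rw [← Matrix.mulVec_mulVec, hx, Matrix.mulVec_zero]

theorem existsUnique_isObliqueProjector {U R : Matrix (Fin n) (Fin t) ℂ}
    (h : IsUnit (Rᴴ * U).det) :
    ∃! P : Matrix (Fin n) (Fin n) ℂ, IsObliqueProjector P (colSpan U) (colSpan R) :=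
  ⟨_, isObliqueProjector_of_isUnit h, fun _ hP => hP.eq (isObliqueProjector_of_isUnit h)⟩

theorem orthProjector_mul_self (K : Submodule ℂ (EuclideanSpace ℂ (Fin n))) :
    orthProjector K * orthProjector K = orthProjector K := by
  rw [orthProjector, ← map_mul]
  exact congrArg _ K.isIdempotentElem_starProjection

/-- The orthogonal projection is the nearest point of K, so any explicit approximant bounds the
distance. -/
theorem norm_sub_orthProjector_le {K : Submodule ℂ (EuclideanSpace ℂ (Fin n))}
    (x : Fin n → ℂ) {y : EuclideanSpace ℂ (Fin n)} (hy : y ∈ K) :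
    ‖WithLp.toLp 2 ((1 - orthProjector K) *ᵥ x)‖ ≤ ‖WithLp.toLp 2 x - y‖ := by
  have h : WithLp.toLp 2 (orthProjector K *ᵥ x) = K.starProjection (WithLp.toLp 2 x) := by
    have : Matrix.toEuclideanCLM (n := Fin n) (𝕜 := ℂ) (orthProjector K) = K.starProjection :=
      StarAlgEquiv.apply_symm_apply _ _
    rw [← this, Matrix.toEuclideanCLM_toLp]
  rw [Matrix.sub_mulVec, Matrix.one_mulVec, WithLp.toLp_sub, h, Submodule.starProjection_minimal]
  exact ciInf_le ⟨0, by rintro _ ⟨z, rfl⟩; positivity⟩ (⟨y, hy⟩ : K)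

/-- For an eigenvector `x` of the pencil, the residual of the projected pencil is controlled by the
distance of `x` to the subspace. -/
theorem norm_residual_le {A B P : Matrix (Fin n) (Fin n) ℂ} {a : ℂ} {x : Fin n → ℂ}
    (hx : (A - a • B) *ᵥ x = 0) {K : Submodule ℂ (EuclideanSpace ℂ (Fin n))}
    {y : EuclideanSpace ℂ (Fin n)} (hy : y ∈ K) :
    ‖WithLp.toLp 2 ((P * A * orthProjector K - a • (P * B * orthProjector K)) *ᵥ x)‖ ≤
      ‖P * (A - a • B) * (1 - orthProjector K)‖ * ‖WithLp.toLp 2 x - y‖ := by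
  set Q := orthProjector K with hQ
  have hQQ : (1 - Q) * (1 - Q) = 1 - Q := by
    rw [Matrix.sub_mul, Matrix.mul_sub, Matrix.mul_sub, hQ, orthProjector_mul_self]
    simp
  -- As A - aB kills x, Q may be replaced by -(1 - Q). Idempotence supplies a second factor 1 - Q:
  -- one enters the operator norm, the other measures the distance from x to K.
  have h : (P * A * Q - a • (P * B * Q)) *ᵥ x =
      -((P * (A - a • B) * (1 - Q)) *ᵥ ((1 - Q) *ᵥ x)) := by
    have h1 : P * A * Q - a • (P * B * Q) = P * (A - a • B) - P * (A - a • B) * (1 - Q) := by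
      simp only [Matrix.mul_sub, Matrix.sub_mul, Matrix.mul_smul, Matrix.smul_mul, Matrix.mul_one]
      abel
    rw [Matrix.mulVec_mulVec, Matrix.mul_assoc _ (1 - Q), hQQ, h1, Matrix.sub_mulVec,
      ← Matrix.mulVec_mulVec, hx, Matrix.mulVec_zero, zero_sub]
  rw [h, WithLp.toLp_neg, norm_neg]
  refine (Matrix.l2_opNorm_mulVec _ (WithLp.toLp 2 ((1 - Q) *ᵥ x))).trans ?_
  exact mul_le_mul_of_nonneg_left (norm_sub_orthProjector_le x hy) (norm_nonneg _)

end Projector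

/-! ### Iterates and powers of the quadrature matrix -/

section Run

variable {n t q : ℕ} {A B : Matrix (Fin n) (Fin n) ℂ} {z w : Fin q → ℂ}
  {Y : Matrix (Fin n) (Fin t) ℂ} {U V : ℕ → Matrix (Fin n) (Fin t) ℂ}

/-- By induction, F^(k+2)Y = F U C = F V C' C, where F V is the next U. Only an inclusion of column
spans is claimed: when U loses rank, the orthonormal V spans more and equality may fail. -/
theorem IsRun.exists_pow_mul_eq (h : IsRun A B z w Y U V) (k : ℕ) :
    ∃ C : Matrix (Fin t) (Fin t) ℂ, quadMat A B z w ^ (k + 1) * Y = U (k + 1) * C := by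
  induction k with
  | zero => exact ⟨1, by rw [h.quad, h.start, zero_add, pow_one, Matrix.mul_one]⟩
  | succ k ih =>
    obtain ⟨C, hC⟩ := ih
    obtain ⟨C', -, hC'⟩ := h.qr k
    refine ⟨C' * C, ?_⟩
    rw [pow_succ', Matrix.mul_assoc, hC, hC', h.quad (k + 1)]
    simp only [Matrix.mul_assoc]

end Run

/-! ### Almost sure invertibility of Z and of R^T F^k Y -/

section Genericity

variable {n t : ℕ}

/-- The matrix of indeterminates indexed by `ι`. -/
noncomputable def indetMatrix {σ : Type*} (ι : Fin n → Fin t → σ) :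
    Matrix (Fin n) (Fin t) (MvPolynomial σ ℂ) :=
  Matrix.of fun a b => MvPolynomial.X (ι a b)

/-- A complex matrix as a matrix of constant polynomials. -/
noncomputable def constMatrix (σ : Type*) {κ κ' : Type*} (G : Matrix κ κ' ℂ) :
    Matrix κ κ' (MvPolynomial σ ℂ) :=
  Matrix.of fun a b => MvPolynomial.C (G a b)

theorem exists_eval_eq_det_mul (G : Matrix (Fin t) (Fin n) ℂ) {σ : Type*}
    (ι : Fin n → Fin t → σ) :
    ∃ p : MvPolynomial σ ℂ, ∀ y : σ → ℂ,
      MvPolynomial.eval y p = (G * Matrix.of fun a b => y (ι a b)).det := by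
  refine ⟨(constMatrix σ G * indetMatrix ι).det, fun y => ?_⟩
  rw [RingHom.map_det]
  congr 1
  ext i j
  simp [Matrix.mul_apply, constMatrix, indetMatrix]

theorem exists_eval_eq_det_transpose_mul_mul (G : Matrix (Fin n) (Fin n) ℂ) {σ : Type*}
    (ι ι' : Fin n → Fin t → σ) :
    ∃ p : MvPolynomial σ ℂ, ∀ y : σ → ℂ, MvPolynomial.eval y p =
      ((Matrix.of fun a b => y (ι' a b))ᵀ * G * Matrix.of fun a b => y (ι a b)).det := by
  refine ⟨((indetMatrix ι')ᵀ * constMatrix σ G * indetMatrix ι).det, fun y => ?_⟩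
  rw [RingHom.map_det]
  congr 1
  ext i j
  simp [Matrix.mul_apply, constMatrix, indetMatrix]

variable {Ω : Type*} [MeasurableSpace Ω] {ρ : Measure Ω} [IsProbabilityMeasure ρ]
  {X : (Fin n × Fin t) ⊕ (Fin n × Fin t) → Ω → ℝ}

theorem ae_det_mul_ne_zero (hX : ∀ i, AEMeasurable (X i) ρ)
    (hat : ∀ i, NullSingletonClass (ρ.map (X i))) (hind : iIndepFun X ρ)
    {G : Matrix (Fin t) (Fin n) ℂ} {Y₀ : Matrix (Fin n) (Fin t) ℂ} (h : (G * Y₀).det ≠ 0) :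
    ∀ᵐ ω ∂ρ, (G * Matrix.of fun a b => (X (Sum.inl (a, b)) ω : ℂ)).det ≠ 0 := by
  obtain ⟨p, hp⟩ := exists_eval_eq_det_mul G
    fun a b => (Sum.inl (a, b) : (Fin n × Fin t) ⊕ (Fin n × Fin t))
  have hp0 : p ≠ 0 := fun h0 => h <| by
    have := hp (Sum.elim (fun x => Y₀ x.1 x.2) 0)
    rw [h0, map_zero] at this
    exact this.symm
  refine (ae_eval_ofReal_ne_zero hX hat hind p hp0).mono fun ω hω => ?_
  rwa [hp] at hω

/-- The transpose keeps the determinant polynomial in the entries and agrees with the adjoint for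
real R. The witnesses may be complex, as they only show that the polynomial is nonzero. -/
theorem ae_det_transpose_mul_mul_ne_zero (hX : ∀ i, AEMeasurable (X i) ρ)
    (hat : ∀ i, NullSingletonClass (ρ.map (X i))) (hind : iIndepFun X ρ)
    {G : Matrix (Fin n) (Fin n) ℂ} {Y₀ R₀ : Matrix (Fin n) (Fin t) ℂ}
    (h : (R₀ᵀ * G * Y₀).det ≠ 0) :
    ∀ᵐ ω ∂ρ, ((Matrix.of fun a b => (X (Sum.inr (a, b)) ω : ℂ))ᵀ * G *
      Matrix.of fun a b => (X (Sum.inl (a, b)) ω : ℂ)).det ≠ 0 := by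
  obtain ⟨p, hp⟩ := exists_eval_eq_det_transpose_mul_mul G
    (fun a b => (Sum.inl (a, b) : (Fin n × Fin t) ⊕ (Fin n × Fin t)))
    (fun a b => (Sum.inr (a, b) : (Fin n × Fin t) ⊕ (Fin n × Fin t)))
  have hp0 : p ≠ 0 := fun h0 => h <| by
    have := hp (Sum.elim (fun x => Y₀ x.1 x.2) (fun x => R₀ x.1 x.2))
    rw [h0, map_zero] at this
    exact this.symm
  refine (ae_eval_ofReal_ne_zero hX hat hind p hp0).mono fun ω hω => ?_
  rwa [hp] at hω

theorem headRows_inv_mul_submatrix (htn : t ≤ n) (S F : Matrix (Fin n) (Fin n) ℂ) :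
    headRows htn S⁻¹ * F * S.submatrix id (Fin.castLE htn) =
      (S⁻¹ * F * S).submatrix (Fin.castLE htn) (Fin.castLE htn) := by
  rfl

theorem inv_mul_pow_mul {S : Matrix (Fin n) (Fin n) ℂ} (hS : IsUnit S)
    (F : Matrix (Fin n) (Fin n) ℂ) (k : ℕ) : S⁻¹ * F ^ k * S = (S⁻¹ * F * S) ^ k := by
  have h := (Matrix.isUnit_iff_isUnit_det _).1 hS
  induction k with
  | zero => simp [Matrix.nonsing_inv_mul _ h]
  | succ k ih =>
    rw [pow_succ, pow_succ, ← ih]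
    simp only [Matrix.mul_assoc]
    rw [Matrix.mul_nonsing_inv_cancel_left _ _ h]

/-- Powers of M stay triangular with diagonal powers, so the leading minor is a product of nonzero
powers. -/
theorem det_head_pow_ne_zero (htn : t ≤ n) {M : Matrix (Fin n) (Fin n) ℂ}
    (hM : M.BlockTriangular id) (hdiag : ∀ i : Fin n, (i : ℕ) < t → M i i ≠ 0) (k : ℕ) :
    ((M ^ k).submatrix (Fin.castLE htn) (Fin.castLE htn)).det ≠ 0 := by
  have hk : (M ^ k).BlockTriangular id ∧ ∀ i, (M ^ k) i i = M i i ^ k := by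
    induction k with
    | zero => exact ⟨by simpa using Matrix.blockTriangular_one, by simp⟩
    | succ k ih =>
      rw [pow_succ]
      exact ⟨ih.1.mul hM, fun i => by
        rw [blockTriangular_mul_apply_self ih.1 hM, ih.2, pow_succ]⟩
  have htri : ((M ^ k).submatrix (Fin.castLE htn) (Fin.castLE htn)).IsUpperTriangular :=
    fun i j hij => hk.1 (i := Fin.castLE htn i) (j := Fin.castLE htn j) (by simpa using hij)
  rw [Matrix.det_of_isUpperTriangular htri]
  refine Finset.prod_ne_zero_iff.2 fun i _ => ?_
  rw [Matrix.submatrix_apply, hk.2]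
  exact pow_ne_zero _ (hdiag _ (by simp))

end Genericity

/-! ### Distance from an eigenvector to the iterated subspace -/

section Distance

variable {n t : ℕ}

/-- M need not be diagonal: its columns off the support of u meet zero coefficients, and the support
does not grow under iteration. -/
theorem pow_mulVec_of_eigen {M : Matrix (Fin n) (Fin n) ℂ} {f : Fin n → ℂ} (k : ℕ)
    {u : Fin n → ℂ} (hu : ∀ i, u i ≠ 0 → M *ᵥ Pi.single i 1 = f i • (Pi.single i 1 : Fin n → ℂ)) :
    M ^ k *ᵥ u = fun i => f i ^ k * u i := by
  induction k with
  | zero => simp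
  | succ k ih =>
    rw [pow_succ', ← Matrix.mulVec_mulVec, ih]
    funext r
    rw [Matrix.mulVec, dotProduct, Finset.sum_eq_single r]
    · by_cases h : u r = 0
      · simp [h]
      · have := congrFun (hu r h) r
        rw [Matrix.mulVec_single_one] at this
        have : M r r = f r := by simpa using this
        rw [this]
        ring
    · intro i _ hi
      by_cases h : u i = 0
      · simp [h]
      · have := congrFun (hu i h) r
        rw [Matrix.mulVec_single_one] at this
        have : M r i = 0 := by simpa [hi.symm] using this
        rw [this, zero_mul]
    · simp

theorem mulVec_eq_tailCols_mulVec (S : Matrix (Fin n) (Fin n) ℂ) {u : Fin n → ℂ}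
    (hu : ∀ i : Fin n, (i : ℕ) < t → u i = 0) :
    S *ᵥ u = tailCols t S *ᵥ fun i => u i := by
  funext r
  simp only [Matrix.mulVec, dotProduct, tailCols, Matrix.submatrix_apply, id]
  rw [← Finset.sum_subtype (Finset.univ.filter fun i : Fin n => t ≤ (i : ℕ)) (by simp)
    fun i => S r i * u i]
  refine (Finset.sum_filter_of_ne fun i _ hi => ?_).symm
  by_contra! h
  exact hi (by rw [hu i h, mul_zero])

theorem norm_toLp_mul_le {ι : Type*} [Fintype ι] {g u : ι → ℂ} {c : ℝ} (hc : 0 ≤ c)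
    (hg : ∀ i, ‖g i‖ ≤ c) :
    ‖WithLp.toLp 2 (fun i => g i * u i)‖ ≤ c * ‖WithLp.toLp 2 u‖ := by
  rw [EuclideanSpace.norm_eq, EuclideanSpace.norm_eq]
  refine Real.sqrt_le_iff.2 ⟨by positivity, ?_⟩
  rw [mul_pow, Real.sq_sqrt (by positivity), Finset.mul_sum]
  refine Finset.sum_le_sum fun i _ => ?_
  rw [norm_mul, mul_pow]
  gcongr
  exact hg i

/-- If the initial head `Z` is nonsingular, the column `p` of `S` is approximated by the range of
`F ^ k Y` with the asserted rate. -/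
theorem exists_norm_col_sub_le (htn : t ≤ n) {S F : Matrix (Fin n) (Fin n) ℂ} (hS : IsUnit S)
    {Y : Matrix (Fin n) (Fin t) ℂ} (hZ : IsUnit (headRows htn S⁻¹ * Y).det) {p : Fin n}
    (hp : (p : ℕ) < t) {a : ℂ} (ha : a ≠ 0)
    (hFp : (S⁻¹ * F * S) *ᵥ Pi.single p 1 = a • (Pi.single p 1 : Fin n → ℂ)) {f : Fin n → ℂ}
    (hF : ∀ i : Fin n, t ≤ i →
      (S⁻¹ * F * S) *ᵥ Pi.single i 1 = f i • (Pi.single i 1 : Fin n → ℂ))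
    {c : ℝ} (hc : 0 ≤ c) (hf : ∀ i : Fin n, t ≤ i → ‖f i‖ ≤ c) (k : ℕ) :
    ∃ v : Fin t → ℂ, ‖WithLp.toLp 2 (S.col p) - WithLp.toLp 2 ((F ^ k * Y) *ᵥ v)‖ ≤
      tau htn S Y p * (c / ‖a‖) ^ k := by
  have hSd := (Matrix.isUnit_iff_isUnit_det _).1 hS
  set e : Fin n → ℂ := Pi.single p 1 with he
  -- Solving Zv = e_p makes the first t coordinates of S⁻¹Yv equal to e_p, so the error `u` lives on
  -- the tail, where it is E e_p.
  set v : Fin t → ℂ := (headRows htn S⁻¹ * Y)⁻¹ *ᵥ (e ∘ Fin.castLE htn) with hv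
  set u : Fin n → ℂ := S⁻¹ *ᵥ (Y *ᵥ v) - e with hu
  have hu0 : ∀ i : Fin n, (i : ℕ) < t → u i = 0 := by
    intro i hi
    have h : (headRows htn S⁻¹ * Y) *ᵥ v = e ∘ Fin.castLE htn := by
      rw [hv, Matrix.mulVec_mulVec, Matrix.mul_nonsing_inv _ hZ, Matrix.one_mulVec]
    rw [← Matrix.mulVec_mulVec] at h
    have := congrFun h ⟨i, hi⟩
    rw [hu, Pi.sub_apply, sub_eq_zero]
    exact this
  have hut : (fun i : {i : Fin n // t ≤ (i : ℕ)} => u i) =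
      startError htn S Y *ᵥ (e ∘ Fin.castLE htn) := by
    funext i
    rw [startError, ← Matrix.mulVec_mulVec, ← hv, ← Matrix.mulVec_mulVec]
    have : e i = 0 := Pi.single_eq_of_ne (fun h => by have := i.2; rw [h] at this; omega) _
    rw [hu, Pi.sub_apply, this, sub_zero]
    rfl
  have hpow : (S⁻¹ * F ^ k * S) *ᵥ (S⁻¹ *ᵥ (Y *ᵥ v)) = a ^ k • e + fun i => f i ^ k * u i := by
    have h1 : S⁻¹ *ᵥ (Y *ᵥ v) = e + u := by rw [hu]; abel
    have h2 := pow_mulVec_of_eigen (M := S⁻¹ * F * S) (f := f) (u := u) k fun i hi =>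
      hF i (not_lt.1 fun h => hi (hu0 i h))
    have h3 := pow_mulVec_of_eigen (M := S⁻¹ * F * S) (f := fun _ => a) (u := e) k fun i hi => by
      have : i = p := by
        by_contra h
        exact hi (Pi.single_eq_of_ne h _)
      rw [this, ← he]
      exact hFp
    rw [inv_mul_pow_mul hS, h1, Matrix.mulVec_add, h2, h3]
    rfl
  have hFY : (F ^ k * Y) *ᵥ v = a ^ k • S.col p + S *ᵥ fun i => f i ^ k * u i := by
    have := congrArg (fun x => S *ᵥ x) hpow
    simp only [Matrix.mulVec_mulVec, Matrix.mulVec_add, Matrix.mulVec_smul] at this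
    rw [he, Matrix.mulVec_single_one] at this
    rw [← this]
    congr 1
    simp only [Matrix.mul_assoc]
    rw [Matrix.mul_nonsing_inv_cancel_left _ _ hSd, Matrix.mul_nonsing_inv_cancel_left _ _ hSd]
  -- This normalisation makes the e_p component exactly the column p of S; what remains is the
  -- propagated tail.
  refine ⟨(a ^ k)⁻¹ • v, ?_⟩
  have hak : a ^ k ≠ 0 := pow_ne_zero _ ha
  have hdiff : WithLp.toLp 2 (S.col p) - WithLp.toLp 2 ((F ^ k * Y) *ᵥ ((a ^ k)⁻¹ • v)) =
      -((a ^ k)⁻¹ • WithLp.toLp 2 (tailCols t S *ᵥ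
        fun i : {i : Fin n // t ≤ (i : ℕ)} => f i ^ k * u i)) := by
    rw [← WithLp.toLp_sub, ← WithLp.toLp_smul, ← WithLp.toLp_neg, Matrix.mulVec_smul, hFY,
      smul_add, smul_smul, inv_mul_cancel₀ hak, one_smul,
      mulVec_eq_tailCols_mulVec (t := t) S (u := fun i => f i ^ k * u i)
        (fun i hi => by rw [hu0 i hi, mul_zero])]
    congr 1
    abel
  rw [hdiff, norm_neg, norm_smul, norm_inv, norm_pow]
  have h1 : ‖WithLp.toLp 2 (tailCols t S *ᵥ
      fun i : {i : Fin n // t ≤ (i : ℕ)} => f i ^ k * u i)‖ ≤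
      ‖tailCols t S‖ * (c ^ k * ‖WithLp.toLp 2 (startError htn S Y *ᵥ (e ∘ Fin.castLE htn))‖) := by
    refine (Matrix.l2_opNorm_mulVec (tailCols t S) (WithLp.toLp 2 _)).trans ?_
    refine mul_le_mul_of_nonneg_left ?_ (norm_nonneg _)
    rw [← hut]
    refine norm_toLp_mul_le (by positivity) fun i => ?_
    rw [norm_pow]
    exact pow_le_pow_left₀ (norm_nonneg _) (hf i i.2) k
  calc (‖a‖ ^ k)⁻¹ * _ ≤ (‖a‖ ^ k)⁻¹ * _ := mul_le_mul_of_nonneg_left h1 (by positivity)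
    _ = tau htn S Y p * (c / ‖a‖) ^ k := by
      rw [tau, div_pow]
      ring

end Distance

end RFEAST

/-! ### The convergence theorem -/

theorem theorem4p3 {n t m m' q l : ℕ}
    -- the pencil and its Weierstrass canonical form
    (A B S T : Matrix (Fin n) (Fin n) ℂ)
    (d : Fin m → ℕ) (hd : ∀ i, 0 < d i) (lam : Fin m → ℂ) (d' : Fin m' → ℕ)
    (hn : ∑ i, d i + ∑ i, d' i = n)
    (hW : RFEAST.IsWeierstrassForm A B d lam d' hn S T)
    -- the simple closed curve, with exactly the first `l` blocks inside
    (Γ : C(Circle, ℂ)) (hΓ : Function.Injective Γ)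
    (hin : ∀ i : Fin m, (i : ℕ) < l → RFEAST.Inside Γ (lam i))
    (hout : ∀ i : Fin m, l ≤ (i : ℕ) → RFEAST.Outside Γ (lam i))
    -- the eigenvalues outside, finite or infinite, have blocks of size one
    (hsimple : ∀ i : Fin m, l ≤ (i : ℕ) → d i = 1)
    (hsimple' : ∀ i, d' i = 1)
    -- the quadrature nodes and weights, and the ordering of the eigenvalues
    (z w : Fin q → ℂ) (hz : ∀ i, z i ∈ Set.range Γ)
    (hanti : Antitone fun i => ‖RFEAST.quadFun z w (lam i)‖)
    (hgap : ∀ i i' : Fin m, (i : ℕ) < l → l ≤ (i' : ℕ) →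
      ‖RFEAST.quadFun z w (lam i')‖ < ‖RFEAST.quadFun z w (lam i)‖)
    -- the subspace size `t > s` and the index `l'`
    (htn : t ≤ n) (hst : ∑ i ∈ Finset.univ.filter (fun i : Fin m => (i : ℕ) < l), d i < t)
    (l' : Fin m) (hl'lt : ∑ i with i < l', d i < t) (hl'le : t ≤ ∑ i with i ≤ l', d i)
    -- the real random starting matrix and the real random left matrices
    {Ω : Type*} [MeasurableSpace Ω] (ρ : Measure Ω) [IsProbabilityMeasure ρ]
    (μ : Measure ℝ) [NullSingletonClass μ] (ν : ℕ → Measure ℝ) [∀ k, NullSingletonClass (ν k)]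
    (Y : Ω → Matrix (Fin n) (Fin t) ℝ) (R : ℕ → Ω → Matrix (Fin n) (Fin t) ℝ)
    (hY : ∀ a b, HasLaw (fun ω => Y ω a b) μ ρ)
    (hR : ∀ k a b, HasLaw (fun ω => R k ω a b) (ν k) ρ)
    (hindep : ∀ k, iIndepFun
      (Sum.elim (fun (p : Fin n × Fin t) (ω : Ω) => Y ω p.1 p.2)
        (fun (p : Fin n × Fin t) (ω : Ω) => R k ω p.1 p.2)) ρ) :
    ∀ᵐ ω ∂ρ, ∀ U V : ℕ → Matrix (Fin n) (Fin t) ℂ,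
      RFEAST.IsRun A B z w ((Y ω).map Complex.ofReal) U V → ∀ k, 1 ≤ k →
        -- the oblique projector exists and is unique
        (RFEAST.quadFun z w (lam l') ≠ 0 →
          ∃! P : Matrix (Fin n) (Fin n) ℂ, RFEAST.IsObliqueProjector P
            (RFEAST.colSpan (U k)) (RFEAST.colSpan ((R k ω).map Complex.ofReal))) ∧
        -- the residual bound
        ∀ P Q : Matrix (Fin n) (Fin n) ℂ,
          RFEAST.IsObliqueProjector P
            (RFEAST.colSpan (U k)) (RFEAST.colSpan ((R k ω).map Complex.ofReal)) →
          Q = RFEAST.orthProjector (RFEAST.colSpan (U k)) →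
          ∀ j : Fin m, (j : ℕ) < l →
            ‖WithLp.toLp 2 ((P * A * Q - lam j • (P * B * Q)) *ᵥ
                S.col (RFEAST.firstCol d hd d' hn j))‖ ≤
              ‖P * (A - lam j • B) * (1 - Q)‖ *
              RFEAST.tau htn S ((Y ω).map Complex.ofReal) (RFEAST.firstCol d hd d' hn j) *
              (‖RFEAST.quadFun z w (lam l')‖ / ‖RFEAST.quadFun z w (lam j)‖) ^ k := by
  have hd' := hsimple'
  have hzl : ∀ i j, z i ≠ lam j := by
    intro i j h
    by_cases hj : (j : ℕ) < l
    · exact (hin j hj).1 (h ▸ hz i)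
    · exact (hout j (not_lt.1 hj)).1 (h ▸ hz i)
  -- Since t > s, block l' lies outside Γ, so the strict gap applies to it.
  have hl' : l ≤ (l' : ℕ) := by
    by_contra! h
    exact absurd (hl'le.trans (RFEAST.sum_le_le_sum_val_lt d h)) hst.not_ge
  have hX (k : ℕ) : ∀ i, AEMeasurable ((Sum.elim (fun (p : Fin n × Fin t) (ω : Ω) => Y ω p.1 p.2)
      (fun (p : Fin n × Fin t) (ω : Ω) => R k ω p.1 p.2)) i) ρ := by
    rintro (i | i)
    · exact (hY i.1 i.2).aemeasurable
    · exact (hR k i.1 i.2).aemeasurable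
  have hat (k : ℕ) : ∀ i, NullSingletonClass (ρ.map ((Sum.elim
      (fun (p : Fin n × Fin t) (ω : Ω) => Y ω p.1 p.2)
      (fun (p : Fin n × Fin t) (ω : Ω) => R k ω p.1 p.2)) i)) := by
    rintro (i | i)
    · rw [Sum.elim_inl, (hY i.1 i.2).map_eq]
      infer_instance
    · rw [Sum.elim_inr, (hR k i.1 i.2).map_eq]
      infer_instance
  have hSd := (Matrix.isUnit_iff_isUnit_det _).1 hW.isUnit_S
  -- Taking the first t columns of S for Y turns Z into the identity. Only Y matters here, so the
  -- joint family with any R^(k) serves; k = 0 is used.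
  have hZ : ∀ᵐ ω ∂ρ, (RFEAST.headRows htn S⁻¹ * (Y ω).map Complex.ofReal).det ≠ 0 := by
    refine RFEAST.ae_det_mul_ne_zero (hX 0) (hat 0) (hindep 0)
      (Y₀ := S.submatrix id (Fin.castLE htn)) ?_
    have h : RFEAST.headRows htn S⁻¹ * S.submatrix id (Fin.castLE htn) =
        (S⁻¹ * S).submatrix (Fin.castLE htn) (Fin.castLE htn) := rfl
    rw [h, Matrix.nonsing_inv_mul _ hSd, Matrix.submatrix_one _ (Fin.castLE_injective htn),
      Matrix.det_one]
    exact one_ne_zero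
  have hD : ∀ᵐ ω ∂ρ, RFEAST.quadFun z w (lam l') ≠ 0 → ∀ k,
      (((R k ω).map Complex.ofReal)ᵀ * RFEAST.quadMat A B z w ^ k *
        (Y ω).map Complex.ofReal).det ≠ 0 := by
    by_cases h0 : RFEAST.quadFun z w (lam l') = 0
    · exact Filter.Eventually.of_forall fun _ h => absurd h0 h
    · have : ∀ᵐ ω ∂ρ, ∀ k, (((R k ω).map Complex.ofReal)ᵀ * RFEAST.quadMat A B z w ^ k *
        (Y ω).map Complex.ofReal).det ≠ 0 := by
        refine ae_all_iff.2 fun k => ?_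
        -- With these witnesses the product is the leading t × t block of M^k, whose diagonal
        -- entries are at least |f̃(λ_l')|^k > 0 in modulus.
        refine RFEAST.ae_det_transpose_mul_mul_ne_zero (hX k) (hat k) (hindep k)
          (Y₀ := S.submatrix id (Fin.castLE htn)) (R₀ := (RFEAST.headRows htn S⁻¹)ᵀ) ?_
        rw [Matrix.transpose_transpose, RFEAST.headRows_inv_mul_submatrix,
          RFEAST.inv_mul_pow_mul hW.isUnit_S]
        refine RFEAST.det_head_pow_ne_zero htn
          (RFEAST.quadForm_blockTriangular hW hd' hzl) (fun i hi => ?_) k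
        have h1 := RFEAST.quadForm_apply_self (z := z) (w := w) hW hd' hzl i
        have h2 := RFEAST.norm_le_norm_blockFun (d' := d') (hn := hn) hanti hl'le hi
        rw [← h1] at h2
        exact norm_pos_iff.1 ((norm_pos_iff.2 h0).trans_le h2)
      exact this.mono fun _ h _ => h
  filter_upwards [hZ, hD] with ω hZω hDω
  intro U V hrun k hk
  obtain ⟨k, rfl⟩ := Nat.exists_eq_add_of_le' hk
  obtain ⟨C, hC⟩ := hrun.exists_pow_mul_eq k
  constructor
  · intro h0
    refine RFEAST.existsUnique_isObliqueProjector ?_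
    have h := hDω h0 (k + 1)
    have hR' : ((R (k + 1) ω).map Complex.ofReal)ᴴ = ((R (k + 1) ω).map Complex.ofReal)ᵀ := by
      ext i j
      simp
    -- Now det(R^T F^(k+1) Y) = det(R^T U) det C, so R^T U is invertible.
    rw [Matrix.mul_assoc, hC, ← Matrix.mul_assoc, Matrix.det_mul] at h
    rw [hR', isUnit_iff_ne_zero]
    exact left_ne_zero_of_mul h
  · rintro P Q - rfl j hj
    have hgapj := hgap j l' hj hl'
    -- The strict gap forces this even when f̃(λ_l') = 0, so the bound needs no such assumption.
    have ha : RFEAST.quadFun z w (lam j) ≠ 0 :=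
      norm_pos_iff.1 ((norm_nonneg (RFEAST.quadFun z w (lam l'))).trans_lt hgapj)
    obtain ⟨v, hv⟩ := RFEAST.exists_norm_col_sub_le htn hW.isUnit_S (isUnit_iff_ne_zero.2 hZω)
      (p := RFEAST.firstCol d hd d' hn j) (F := RFEAST.quadMat A B z w)
      ((RFEAST.blockEquiv_lt_of_val_lt d d' hn _ hj).trans hst) ha
      (RFEAST.quadForm_mulVec_inl hW hd' hzl j ⟨0, hd j⟩ rfl)
      (fun i hi => RFEAST.quadForm_mulVec_tail hW hd' hzl hsimple (hst.le.trans hi))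
      (norm_nonneg _) (fun i hi => RFEAST.norm_blockFun_le
        (g := fun i => RFEAST.quadFun z w (lam i)) hanti hl'lt hi) (k + 1)
    rw [hC, ← Matrix.mulVec_mulVec] at hv
    refine (RFEAST.norm_residual_le (RFEAST.mulVec_col_firstCol hW hd hd' j)
      (RFEAST.mem_colSpan.2 ⟨C *ᵥ v, rfl⟩)).trans ?_
    refine (mul_le_mul_of_nonneg_left hv (by exact norm_nonneg _)).trans_eq ?_
    exact (mul_assoc _ _ _).symm
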